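/- For $n\ge 1$ and $\alpha,\beta\in\mathbb{R}^n$ write $\|\cdot\|$ for the Euclidean norm and $\langle\alpha,X\rangle=\sum_{i=1}^n\alpha_iX_i$. A constant $C$ is called \emph{admissible for symmetric log-concave densities} if for every $n$, all $X_1,\dots,X_n$ that are i.i.d. with a log-concave density symmetric about $0$, and all $\alpha,\beta\in\mathbb{R}^n$ with $\alpha\neq 0$, $$\mathbf{P}\{|\langle\alpha,X\rangle|\le|\langle\beta,X\rangle|\}\le C\,\frac{\|\beta\|}{\|\alpha\|}.\qquad(1)$$ Let $X_i=\xi_iY_i$, $1\le i\le n$, where the $Y_i$ are i.i.d. with a log-concave density symmetric about $0$, the $\xi_i$ are i.i.d. positive random variables with $\mathbf{E}[\xi_1^2]\le B$ and $\mathbf{E}[1/\xi_1^2]\le B$ for some $B$, and the family $(\xi_i)$ is independent of the family $(Y_i)$. Then for all $\alpha,\beta\in\mathbb{R}^n$ with $\alpha\ne0$, $$\mathbf{P}\{|\langle\alpha,X\rangle|\le|\langle\beta,X\rangle|\}\le C\,B\,\frac{\|\beta\|}{\|\alpha\|},\qquad(2)$$ where $C>0$ is an absolute constant, namely the constant of the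 inequality (1) for symmetric log-concave densities. That is: there is an absolute constant $C>0$ that is admissible for symmetric log-concave densities and for which (2) holds in all these situations; and (2) holds with every $C$ that is admissible for symmetric log-concave densities. -/

import Mathlib

open MeasureTheory ProbabilityTheory

universe u

/-- A nonnegative function on the line that is log-concave:
`f (a x + b y) ≥ f(x)^a f(y)^b` for `a, b > 0`, `a + b = 1`. The value `0` is allowed, so the
support may be any interval. -/
def IsLogConcave (f : ℝ → ℝ) : Prop :=
  (∀ x, 0 ≤ f x) ∧
    ∀ x y a b : ℝ, 0 < a → 0 < b → a + b = 1 → f x ^ a * f y ^ b ≤ f (a * x + b * y)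

/-- `μ` has a log-concave density with respect to Lebesgue measure that is symmetric about `0`. -/
def HasSymmetricLogConcaveDensity (μ : Measure ℝ) : Prop :=
  ∃ f : ℝ → ℝ, Measurable f ∧ IsLogConcave f ∧ (∀ x, f (-x) = f x) ∧
    μ = volume.withDensity (fun x => ENNReal.ofReal (f x))

/-- `X 0, …, X (n-1)` are independent and identically distributed real random variables. -/
def IsIID {Ω : Type u} [MeasurableSpace Ω] (P : Measure Ω) {n : ℕ} (X : Fin n → Ω → ℝ) : Prop :=
  (∀ i, Measurable (X i)) ∧ iIndepFun X P ∧ ∀ i j, IdentDistrib (X i) (X j) P P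

/-- The probability of the event `|⟨α, X⟩| ≤ |⟨β, X⟩|`. -/
noncomputable def domProb {Ω : Type u} [MeasurableSpace Ω] (P : Measure Ω) {n : ℕ}
    (α β : EuclideanSpace ℝ (Fin n)) (X : Fin n → Ω → ℝ) : ℝ :=
  P.real {ω | |∑ i, α i * X i ω| ≤ |∑ i, β i * X i ω|}

/-- The constant `C` is admissible in the inequality
`P{|⟨α, X⟩| ≤ |⟨β, X⟩|} ≤ C ‖β‖ / ‖α‖` for i.i.d. `X i` with a symmetric log-concave density,
uniformly in the dimension, the vectors and the density. -/
def LogConcaveBound (C : ℝ) : Prop :=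
  ∀ (Ω : Type u) [MeasurableSpace Ω] (P : Measure Ω) [IsProbabilityMeasure P]
    (n : ℕ) (X : Fin n → Ω → ℝ),
    IsIID P X → (∀ i, HasSymmetricLogConcaveDensity (P.map (X i))) →
    ∀ α β : EuclideanSpace ℝ (Fin n), α ≠ 0 →
      domProb P α β X ≤ C * (‖β‖ / ‖α‖)

/-- The constant `C` is admissible in the inequality
`P{|⟨α, X⟩| ≤ |⟨β, X⟩|} ≤ C B ‖β‖ / ‖α‖` for `X i = ξ i * Y i` with `Y i` i.i.d. with a symmetric
log-concave density, `ξ i` i.i.d. positive with `E ξ² ≤ B` and `E ξ⁻² ≤ B`, the two families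
being independent of each other. -/
def MixedLogConcaveBound (C : ℝ) : Prop :=
  ∀ (Ω : Type u) [MeasurableSpace Ω] (P : Measure Ω) [IsProbabilityMeasure P]
    (n : ℕ) (ξ Y : Fin n → Ω → ℝ) (B : ℝ),
    IsIID P Y → (∀ i, HasSymmetricLogConcaveDensity (P.map (Y i))) →
    IsIID P ξ → (∀ i, ∀ᵐ ω ∂P, 0 < ξ i ω) →
    (∀ i, Integrable (fun ω => ξ i ω ^ 2) P ∧ ∫ ω, ξ i ω ^ 2 ∂P ≤ B) →
    (∀ i, Integrable (fun ω => 1 / ξ i ω ^ 2) P ∧ ∫ ω, 1 / ξ i ω ^ 2 ∂P ≤ B) →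
    IndepFun (fun ω i => ξ i ω) (fun ω i => Y i ω) P →
    ∀ α β : EuclideanSpace ℝ (Fin n), α ≠ 0 →
      domProb P α β (fun i ω => ξ i ω * Y i ω) ≤ C * B * (‖β‖ / ‖α‖)

/-! The second assertion is conditioning on the scales: given `ξ = x`, the event is the one for `Y`
with coefficients `α i * x i` and `β i * x i`, so its probability is at most `C` times the ratio of
the rescaled norms. Cauchy–Schwarz and AM-GM (`norm_ratio_le`) bound this ratio by an expression
linear in `ξ i ^ 2` and `1 / ξ i ^ 2`, whose expectation is at most `B * (‖β‖ / ‖α‖)`.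

For the first assertion an admissible constant is exhibited. By Prékopa–Leindler, a nontrivial
linear combination of the variables again has a symmetric log-concave density; such a density is at
most a constant over the standard deviation. Hence a sum over a block `K` of indices is unlikely to
fall in a short interval whose centre and length depend only on the other indices
(`IsIID.measureReal_block_le`). If no coordinate carries a quarter of `‖α‖ ^ 2`, the indices split
into two blocks that each carry at least a quarter, and `⟨β, X⟩` is controlled by its larger block
part while the other block supplies the density. Otherwise the dominant coordinate supplies the
density, and its share of `⟨β, X⟩` is absorbed into the left side. -/

/-! ### Brunn–Minkowski and Prékopa–Leindler on the line. -/

/-- One-dimensional Brunn–Minkowski inequality for compact sets. -/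
lemma volume_add_le_of_isCompact {K L C : Set ℝ} (hK : IsCompact K) (hL : IsCompact L)
    (hK0 : K.Nonempty) (hL0 : L.Nonempty) (h : ∀ x ∈ K, ∀ y ∈ L, x + y ∈ C) :
    volume K + volume L ≤ volume C := by
  obtain ⟨k, hkK, hk⟩ := hK.exists_isGreatest hK0
  obtain ⟨l, hlL, hl⟩ := hL.exists_isLeast hL0
  have h1 : volume ((fun x => x + l) '' K) = volume K := by simp
  have h2 : volume ((fun x => k + x) '' L) = volume L := by simp
  have hm : MeasurableSet ((fun x => k + x) '' L) :=
    (hL.image (by fun_prop)).measurableSet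
  have h3 := measure_union_add_inter (μ := volume) ((fun x => x + l) '' K) hm
  -- One translate lies to the left of `k + l`, the other to its right.
  have h4 : volume (((fun x => x + l) '' K) ∩ ((fun x => k + x) '' L)) = 0 := by
    refine measure_mono_null (t := {k + l}) ?_ (by simp)
    rintro _ ⟨⟨x, hx, rfl⟩, ⟨y, hy, hxy⟩⟩
    have := hk hx
    have := hl hy
    simp only [Set.mem_singleton_iff] at *
    linarith
  rw [h1, h2, h4, add_zero] at h3
  rw [← h3]
  refine measure_mono (Set.union_subset ?_ ?_)
  · rintro _ ⟨x, hx, rfl⟩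
    exact h x hx l hlL
  · rintro _ ⟨x, hx, rfl⟩
    exact h k hkK x hx

/-- One-dimensional Brunn–Minkowski inequality for measurable sets. -/
lemma volume_add_le_of_measurableSet {A B C : Set ℝ} (hA : MeasurableSet A) (hB : MeasurableSet B)
    (hA0 : A.Nonempty) (hB0 : B.Nonempty) (h : ∀ x ∈ A, ∀ y ∈ B, x + y ∈ C) :
    volume A + volume B ≤ volume C := by
  obtain ⟨a, ha⟩ := hA0
  obtain ⟨b, hb⟩ := hB0
  rw [hA.measure_eq_iSup_isCompact, hB.measure_eq_iSup_isCompact]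
  simp_rw [iSup_and']
  refine ENNReal.biSup_add_biSup_le' ⟨∅, by simp⟩ ⟨∅, by simp⟩ ?_
  rintro K ⟨hKA, hK⟩ L ⟨hLB, hL⟩
  -- Inner regularity also offers empty compact sets; adding a point to each makes them nonempty.
  calc volume K + volume L ≤ volume (insert a K) + volume (insert b L) := by
        gcongr <;> exact Set.subset_insert _ _
    _ ≤ volume C := by
        refine volume_add_le_of_isCompact (hK.insert a) (hL.insert b) (by simp) (by simp) ?_
        intro x hx y hy
        exact h x (Set.insert_subset ha hKA hx) y (Set.insert_subset hb hLB hy)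

lemma volume_combination_le {A B C : Set ℝ} {a b : ℝ} (ha : 0 < a) (hb : 0 < b)
    (hA : MeasurableSet A) (hB : MeasurableSet B) (hA0 : A.Nonempty) (hB0 : B.Nonempty)
    (h : ∀ x ∈ A, ∀ y ∈ B, a * x + b * y ∈ C) :
    ENNReal.ofReal a * volume A + ENNReal.ofReal b * volume B ≤ volume C := by
  have key := volume_add_le_of_measurableSet (C := C)
    (hA.const_smul_of_ne_zero ha.ne') (hB.const_smul_of_ne_zero hb.ne')
    (hA0.smul_set (a := a)) (hB0.smul_set (a := b)) (by
      rintro _ ⟨x, hx, rfl⟩ _ ⟨y, hy, rfl⟩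
      exact h x hx y hy)
  simpa [Measure.addHaar_smul, abs_of_pos ha, abs_of_pos hb] using key

/-- Arithmetic form of the Prékopa–Leindler inequality, for functions with supremum one. -/
lemma lintegral_combination_le {F G H : ℝ → ℝ} {a b : ℝ} (ha : 0 < a) (hb : 0 < b)
    (hF : Measurable F) (hG : Measurable G) (hH : Measurable H)
    (hF0 : ∀ x, 0 ≤ F x) (hG0 : ∀ x, 0 ≤ G x) (hH0 : ∀ x, 0 ≤ H x)
    (hF1 : IsLUB (Set.range F) 1) (hG1 : IsLUB (Set.range G) 1)
    (h : ∀ t, 0 < t → ∀ x y, t < F x → t < G y → t < H (a * x + b * y)) :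
    ENNReal.ofReal a * (∫⁻ x, ENNReal.ofReal (F x)) +
        ENNReal.ofReal b * (∫⁻ x, ENNReal.ofReal (G x)) ≤
      ∫⁻ x, ENNReal.ofReal (H x) := by
  rw [lintegral_eq_lintegral_meas_lt volume (.of_forall hF0) hF.aemeasurable,
    lintegral_eq_lintegral_meas_lt volume (.of_forall hG0) hG.aemeasurable,
    lintegral_eq_lintegral_meas_lt volume (.of_forall hH0) hH.aemeasurable,
    ← lintegral_const_mul' _ _ ENNReal.ofReal_ne_top,
    ← lintegral_const_mul' _ _ ENNReal.ofReal_ne_top, ← lintegral_add_left]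
  · refine setLIntegral_mono' measurableSet_Ioi fun t ht => ?_
    -- Both suprema are 1, so the superlevel sets of `F` and `G` are nonempty for the same levels `t
    -- < 1`, as Brunn–Minkowski requires, and both empty for `t ≥ 1`.
    rcases lt_or_ge t 1 with ht1 | ht1
    · obtain ⟨_, ⟨x, rfl⟩, hx, -⟩ := hF1.exists_between ht1
      obtain ⟨_, ⟨y, rfl⟩, hy, -⟩ := hG1.exists_between ht1
      exact volume_combination_le ha hb (measurableSet_lt measurable_const hF)
        (measurableSet_lt measurable_const hG) ⟨x, hx⟩ ⟨y, hy⟩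
        fun x hx y hy => h t ht x y hx hy
    · have e1 : {x | t < F x} = ∅ := by
        ext x
        simpa using (hF1.1 ⟨x, rfl⟩).trans ht1
      have e2 : {x | t < G x} = ∅ := by
        ext x
        simpa using (hG1.1 ⟨x, rfl⟩).trans ht1
      simp [e1, e2]
  · refine Measurable.const_mul (Antitone.measurable fun s t hst => ?_) _
    exact measure_mono fun x hx => lt_of_le_of_lt hst hx

lemma isLUB_range_div {F : ℝ → ℝ} {p : ℝ} (hp : 0 < p) (h : IsLUB (Set.range F) p) :
    IsLUB (Set.range fun x => F x / p) 1 := by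
  constructor
  · rintro _ ⟨x, rfl⟩
    exact (div_le_one hp).2 (h.1 ⟨x, rfl⟩)
  · intro c hc
    have : p ≤ c * p := h.2 (by
      rintro _ ⟨x, rfl⟩
      exact (div_le_iff₀ hp).1 (hc ⟨x, rfl⟩))
    nlinarith

lemma lintegral_ofReal_div {F : ℝ → ℝ} {p : ℝ} (hp : 0 < p) :
    ∫⁻ x, ENNReal.ofReal (F x / p) = ENNReal.ofReal p⁻¹ * ∫⁻ x, ENNReal.ofReal (F x) := by
  rw [← lintegral_const_mul' _ _ ENNReal.ofReal_ne_top]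
  refine lintegral_congr fun x => ?_
  rw [← ENNReal.ofReal_mul (by positivity), div_eq_inv_mul]

/-- The Prékopa–Leindler inequality on the real line. -/
lemma prekopa_leindler {F G H : ℝ → ℝ} {a b : ℝ} (ha : 0 < a) (hb : 0 < b) (hab : a + b = 1)
    (hF : Measurable F) (hG : Measurable G) (hH : Measurable H)
    (hF0 : ∀ x, 0 ≤ F x) (hG0 : ∀ x, 0 ≤ G x) (hH0 : ∀ x, 0 ≤ H x)
    (hFb : BddAbove (Set.range F)) (hGb : BddAbove (Set.range G))
    (hFi : ∫⁻ x, ENNReal.ofReal (F x) ≠ ⊤) (hGi : ∫⁻ x, ENNReal.ofReal (G x) ≠ ⊤)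
    (hHi : ∫⁻ x, ENNReal.ofReal (H x) ≠ ⊤)
    (h : ∀ x y, F x ^ a * G y ^ b ≤ H (a * x + b * y)) :
    (∫⁻ x, ENNReal.ofReal (F x)).toReal ^ a * (∫⁻ x, ENNReal.ofReal (G x)).toReal ^ b ≤
      (∫⁻ x, ENNReal.ofReal (H x)).toReal := by
  have hp := isLUB_csSup (Set.range_nonempty F) hFb
  have hq := isLUB_csSup (Set.range_nonempty G) hGb
  set p := sSup (Set.range F)
  set q := sSup (Set.range G)
  have hp0 : 0 ≤ p := (hF0 0).trans (hp.1 ⟨0, rfl⟩)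
  have hq0 : 0 ≤ q := (hG0 0).trans (hq.1 ⟨0, rfl⟩)
  rcases hp0.eq_or_lt with hp0 | hp0
  · have : ∀ x, ENNReal.ofReal (F x) = 0 := fun x =>
      ENNReal.ofReal_eq_zero.2 (hp0 ▸ hp.1 ⟨x, rfl⟩)
    simp [this, Real.zero_rpow ha.ne']
  rcases hq0.eq_or_lt with hq0 | hq0
  · have : ∀ x, ENNReal.ofReal (G x) = 0 := fun x =>
      ENNReal.ofReal_eq_zero.2 (hq0 ▸ hq.1 ⟨x, rfl⟩)
    simp [this, Real.zero_rpow hb.ne']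
  have hpa := Real.rpow_pos_of_pos hp0 a
  have hqb := Real.rpow_pos_of_pos hq0 b
  have key := lintegral_combination_le (F := fun x => F x / p) (G := fun x => G x / q)
    (H := fun x => H x / (p ^ a * q ^ b)) ha hb (hF.div_const _) (hG.div_const _)
    (hH.div_const _) (fun x => div_nonneg (hF0 x) hp0.le) (fun x => div_nonneg (hG0 x) hq0.le)
    (fun x => div_nonneg (hH0 x) (by positivity)) (isLUB_range_div hp0 hp)
    (isLUB_range_div hq0 hq) (by
      intro t ht x y hx hy
      rw [lt_div_iff₀ (by positivity)] at hx hy ⊢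
      refine lt_of_lt_of_le ?_ (h x y)
      calc t * (p ^ a * q ^ b) = (t * p) ^ a * (t * q) ^ b := by
            rw [Real.mul_rpow ht.le hp0.le, Real.mul_rpow ht.le hq0.le]
            nth_rw 1 [← Real.rpow_one t, ← hab, Real.rpow_add ht]
            ring
        _ < F x ^ a * G y ^ b := by
            gcongr)
  rw [lintegral_ofReal_div hp0, lintegral_ofReal_div hq0,
    lintegral_ofReal_div (by positivity)] at key
  have key2 := ENNReal.toReal_mono (ENNReal.mul_ne_top ENNReal.ofReal_ne_top hHi) key
  rw [ENNReal.toReal_add (ENNReal.mul_ne_top ENNReal.ofReal_ne_top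
      (ENNReal.mul_ne_top ENNReal.ofReal_ne_top hFi)) (ENNReal.mul_ne_top ENNReal.ofReal_ne_top
      (ENNReal.mul_ne_top ENNReal.ofReal_ne_top hGi))] at key2
  simp only [ENNReal.toReal_mul] at key2
  rw [ENNReal.toReal_ofReal ha.le, ENNReal.toReal_ofReal hb.le,
    ENNReal.toReal_ofReal (by positivity), ENNReal.toReal_ofReal (by positivity), ENNReal.toReal_ofReal (by positivity)] at key2
  set I := (∫⁻ x, ENNReal.ofReal (F x)).toReal
  set J := (∫⁻ x, ENNReal.ofReal (G x)).toReal
  set K := (∫⁻ x, ENNReal.ofReal (H x)).toReal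
  have hI : 0 ≤ I := ENNReal.toReal_nonneg
  have hJ : 0 ≤ J := ENNReal.toReal_nonneg
  -- AM-GM turns the arithmetic form into the geometric one; the factors `p ^ a * q ^ b` then
  -- cancel.
  have amgm := Real.geom_mean_le_arith_mean2_weighted ha.le hb.le
    (show 0 ≤ p⁻¹ * I by positivity) (show 0 ≤ q⁻¹ * J by positivity) hab
  have := amgm.trans key2
  rw [Real.mul_rpow (by positivity) hI, Real.mul_rpow (by positivity) hJ,
    Real.inv_rpow hp0.le, Real.inv_rpow hq0.le, inv_mul_eq_div (p ^ a * q ^ b),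
    le_div_iff₀ (by positivity)] at this
  calc I ^ a * J ^ b = (p ^ a)⁻¹ * I ^ a * ((q ^ b)⁻¹ * J ^ b) * (p ^ a * q ^ b) := by
        field_simp
    _ ≤ K := this

/-! ### Stability of symmetric log-concave densities under sums and dilations. -/

lemma IsLogConcave.le_zero {f : ℝ → ℝ} (hf : IsLogConcave f) (hs : ∀ x, f (-x) = f x) (x : ℝ) :
    f x ≤ f 0 := by
  have h := hf.2 x (-x) (1 / 2) (1 / 2) (by norm_num) (by norm_num) (by norm_num)
  rw [hs, ← Real.sqrt_eq_rpow, Real.mul_self_sqrt (hf.1 x)] at h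
  simpa using h

lemma lintegral_ofReal_eq_one {f : ℝ → ℝ}
    (hp : IsProbabilityMeasure (volume.withDensity fun x => ENNReal.ofReal (f x))) :
    ∫⁻ x, ENNReal.ofReal (f x) = 1 := by
  have := hp.measure_univ
  rwa [withDensity_apply _ MeasurableSet.univ, Measure.restrict_univ] at this

/-- The class of symmetric log-concave probability densities is stable under convolution. -/
lemma HasSymmetricLogConcaveDensity.conv {μ ν : Measure ℝ} [IsProbabilityMeasure μ]
    [IsProbabilityMeasure ν] (hμ : HasSymmetricLogConcaveDensity μ)
    (hν : HasSymmetricLogConcaveDensity ν) : HasSymmetricLogConcaveDensity (μ.conv ν) := by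
  obtain ⟨f, fm, fl, fs, rfl⟩ := hμ
  obtain ⟨g, gm, gl, gs, rfl⟩ := hν
  have f1 := lintegral_ofReal_eq_one (f := f) inferInstance
  set k : ℝ → ENNReal := fun x => ∫⁻ y, ENNReal.ofReal (f y * g (-y + x)) with hk
  have hfin : ∀ x, k x ≠ ⊤ := fun x => by
    refine ne_top_of_le_ne_top (b := ENNReal.ofReal (g 0)) ENNReal.ofReal_ne_top ?_
    calc k x ≤ ∫⁻ y, ENNReal.ofReal (g 0) * ENNReal.ofReal (f y) := by
          refine lintegral_mono fun y => ?_
          rw [mul_comm (f y), ENNReal.ofReal_mul (gl.1 _)]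
          gcongr
          exact gl.le_zero gs _
      _ = ENNReal.ofReal (g 0) := by
          rw [lintegral_const_mul' _ _ ENNReal.ofReal_ne_top, f1, mul_one]
  have hconv : (fun x => ENNReal.ofReal (f x)) ⋆ₗ[volume] (fun x => ENNReal.ofReal (g x)) = k := by
    ext x
    rw [lconvolution_def]
    exact lintegral_congr fun y => (ENNReal.ofReal_mul (fl.1 y)).symm
  have km : Measurable k := by
    rw [← hconv]
    exact measurable_lconvolution _ fm.ennreal_ofReal gm.ennreal_ofReal
  refine ⟨fun x => (k x).toReal, km.ennreal_toReal, ⟨fun x => ENNReal.toReal_nonneg, ?_⟩, ?_, ?_⟩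
  · intro x y a b ha hb hab
    have bdd : ∀ x, BddAbove (Set.range fun z => f z * g (-z + x)) := fun x => ⟨f 0 * g 0, by
      rintro _ ⟨z, rfl⟩
      exact mul_le_mul (fl.le_zero fs z) (gl.le_zero gs _) (gl.1 _) (fl.1 _)⟩
    -- The integrand `f z * g (-z + x)` is log-concave jointly in `(z, x)`; Prékopa–Leindler
    -- integrates out `z`.
    refine prekopa_leindler ha hb hab (by fun_prop) (by fun_prop) (by fun_prop)
      (fun z => mul_nonneg (fl.1 _) (gl.1 _)) (fun z => mul_nonneg (fl.1 _) (gl.1 _))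
      (fun z => mul_nonneg (fl.1 _) (gl.1 _)) (bdd x) (bdd y) (hfin x) (hfin y) (hfin _) ?_
    intro z w
    rw [Real.mul_rpow (fl.1 _) (gl.1 _), Real.mul_rpow (fl.1 _) (gl.1 _)]
    have h1 := fl.2 z w a b ha hb hab
    have h2 := gl.2 (-z + x) (-w + y) a b ha hb hab
    have e : a * (-z + x) + b * (-w + y) = -(a * z + b * w) + (a * x + b * y) := by ring
    rw [e] at h2
    calc _ = (f z ^ a * f w ^ b) * (g (-z + x) ^ a * g (-w + y) ^ b) := by ring
      _ ≤ _ := mul_le_mul h1 h2 (mul_nonneg (Real.rpow_nonneg (gl.1 _) _)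
          (Real.rpow_nonneg (gl.1 _) _)) (fl.1 _)
  · intro x
    refine congrArg ENNReal.toReal ?_
    simp only [hk]
    rw [← lintegral_neg_eq_self]
    refine lintegral_congr fun y => ?_
    rw [fs, ← gs (-y + x)]
    ring_nf
  · rw [conv_withDensity_eq_lconvolution fm.ennreal_ofReal gm.ennreal_ofReal, hconv]
    congr 1
    ext x
    rw [ENNReal.ofReal_toReal (hfin x)]

/-- Symmetric log-concave densities are stable under nonzero dilations. -/
lemma HasSymmetricLogConcaveDensity.map_const_mul {μ : Measure ℝ}
    (hμ : HasSymmetricLogConcaveDensity μ) {c : ℝ} (hc : c ≠ 0) :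
    HasSymmetricLogConcaveDensity (μ.map fun x => c * x) := by
  obtain ⟨f, fm, fl, fs, rfl⟩ := hμ
  have hc' : 0 < |c⁻¹| := by positivity
  refine ⟨fun x => |c⁻¹| * f (c⁻¹ * x), by fun_prop, ⟨fun x => mul_nonneg hc'.le (fl.1 _), ?_⟩,
    ?_, ?_⟩
  · intro x y a b ha hb hab
    rw [Real.mul_rpow hc'.le (fl.1 _), Real.mul_rpow hc'.le (fl.1 _)]
    have h1 := fl.2 (c⁻¹ * x) (c⁻¹ * y) a b ha hb hab
    have e : a * (c⁻¹ * x) + b * (c⁻¹ * y) = c⁻¹ * (a * x + b * y) := by ring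
    rw [e] at h1
    calc _ = (|c⁻¹| ^ a * |c⁻¹| ^ b) * (f (c⁻¹ * x) ^ a * f (c⁻¹ * y) ^ b) := by ring
      _ ≤ _ := by
        rw [← Real.rpow_add hc', hab, Real.rpow_one]
        exact mul_le_mul_of_nonneg_left h1 hc'.le
  · intro x
    simp [fs]
  · ext s hs
    have hm : Measurable fun x : ℝ => c * x := by fun_prop
    rw [Measure.map_apply hm hs, withDensity_apply _ (hm hs), withDensity_apply _ hs]
    have hmap : (volume : Measure ℝ) = ENNReal.ofReal |c| • volume.map (fun x => c * x) :=
      (Real.smul_map_volume_mul_left hc).symm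
    conv_rhs => rw [hmap]
    rw [Measure.restrict_smul, lintegral_smul_measure, setLIntegral_map hs (by fun_prop) hm,
      smul_eq_mul, ← lintegral_const_mul' _ _ ENNReal.ofReal_ne_top]
    refine lintegral_congr fun x => ?_
    rw [← ENNReal.ofReal_mul (abs_nonneg c), ← mul_assoc, ← abs_mul, mul_inv_cancel₀ hc,
      inv_mul_cancel_left₀ hc]
    simp

/-- The first alternative is unavoidable: with all coefficients zero the law is a point mass.
Otherwise blocks are built up by convolution, skipping zero coefficients. -/
lemma IsIID.sum_density {Ω : Type u} [MeasurableSpace Ω] {P : Measure Ω} [IsProbabilityMeasure P]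
    {n : ℕ} {X : Fin n → Ω → ℝ} (hX : IsIID P X)
    (hd : ∀ i, HasSymmetricLogConcaveDensity (P.map (X i))) (α : Fin n → ℝ)
    (J : Finset (Fin n)) :
    (∀ i ∈ J, α i = 0) ∨
      HasSymmetricLogConcaveDensity (P.map fun ω => ∑ i ∈ J, α i * X i ω) := by
  classical
  obtain ⟨hm, hi, -⟩ := hX
  induction J using Finset.induction_on with
  | empty => simp
  | insert j J hj ih =>
    by_cases h0 : α j = 0
    · rcases ih with ih | ih
      · left
        simpa [h0] using ih
      · right
        simpa [Finset.sum_insert hj, h0] using ih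
    right
    have h1 : HasSymmetricLogConcaveDensity (P.map fun ω => α j * X j ω) := by
      have := (hd j).map_const_mul h0
      rwa [Measure.map_map (by fun_prop) (hm j)] at this
    rcases ih with ih | ih
    · convert h1 using 3 with ω
      rw [Finset.sum_insert hj, Finset.sum_eq_zero, add_zero]
      intro i hi
      simp [ih i hi]
    · have hind : IndepFun (fun ω => α j * X j ω) (fun ω => ∑ i ∈ J, α i * X i ω) P := by
        have h2 := (hi.comp (fun i x => α i * x) fun i => by fun_prop).indepFun_finsetSum_of_notMem
          (fun i => by fun_prop) hj
        convert h2.symm using 1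
        · ext ω
          simp
        · ext ω
          simp
      have e : (fun ω => ∑ i ∈ insert j J, α i * X i ω) =
          (fun ω => α j * X j ω) + fun ω => ∑ i ∈ J, α i * X i ω := by
        ext ω
        simp [Finset.sum_insert hj]
      rw [e, hind.map_add_eq_map_conv_map (by fun_prop) (by fun_prop)]
      have : IsProbabilityMeasure (P.map fun ω => α j * X j ω) :=
        Measure.isProbabilityMeasure_map (by fun_prop)
      have : IsProbabilityMeasure (P.map fun ω => ∑ i ∈ J, α i * X i ω) :=
        Measure.isProbabilityMeasure_map (by fun_prop)
      exact h1.conv ih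

/-! ### Tails, second moment and concentration of one density. -/

lemma IsLogConcave.antitoneOn {f : ℝ → ℝ} (hf : IsLogConcave f) (hs : ∀ x, f (-x) = f x)
    {x y : ℝ} (hx : 0 < x) (hxy : x < y) : f y ≤ f x := by
  have hy : 0 < y := hx.trans hxy
  have h := hf.2 y 0 (x / y) (1 - x / y) (by positivity) (by
    rw [sub_pos, div_lt_one hy]; exact hxy) (by ring)
  rw [mul_zero, add_zero, div_mul_cancel₀ _ hy.ne'] at h
  refine le_trans ?_ h
  have hle := hf.le_zero hs y
  rcases (hf.1 y).eq_or_lt with h0 | h0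
  · rw [← h0]
    exact mul_nonneg (Real.rpow_nonneg le_rfl _) (Real.rpow_nonneg (hf.1 _) _)
  · calc f y = f y ^ (x / y) * f y ^ (1 - x / y) := by
          rw [← Real.rpow_add h0]; simp
      _ ≤ _ := by
        refine mul_le_mul_of_nonneg_left ?_ (Real.rpow_nonneg h0.le _)
        refine Real.rpow_le_rpow h0.le hle ?_
        rw [sub_nonneg, div_le_one hy]; exact hxy.le

/-- A symmetric log-concave probability density `f` has exponential tails at scale `1 / f 0`. -/
lemma IsLogConcave.le_exp {f : ℝ → ℝ} (hf : IsLogConcave f) (hs : ∀ x, f (-x) = f x)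
    (h1 : ∫⁻ x, ENNReal.ofReal (f x) = 1) :
    0 < f 0 ∧ ∀ x, f x ≤ Real.exp 1 * f 0 * Real.exp (-(f 0 / 2) * |x|) := by
  have hM : 0 < f 0 := by
    refine (hf.1 0).lt_of_ne fun h0 => ?_
    have : ∀ x, ENNReal.ofReal (f x) = 0 := fun x =>
      ENNReal.ofReal_eq_zero.2 ((hf.le_zero hs x).trans h0.symm.le)
    simp [this] at h1
  refine ⟨hM, ?_⟩
  have hx0 : 0 < 2 / f 0 := by positivity
  -- On an interval of length `4 / f 0` the density is at least `f (2 / f 0)`, so total mass 1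
  -- forces `f (2 / f 0) ≤ f 0 / 4`, and `1 / 4 ≤ exp (-1)`.
  have hsmall : f (2 / f 0) ≤ f 0 * Real.exp (-1) := by
    have hmass : ENNReal.ofReal (f (2 / f 0)) * ENNReal.ofReal (4 / f 0) ≤ 1 := by
      calc _ = ∫⁻ x in Set.Ioo (-(2 / f 0)) (2 / f 0), ENNReal.ofReal (f (2 / f 0)) := by
            rw [setLIntegral_const, Real.volume_Ioo]
            congr 2
            ring
        _ ≤ ∫⁻ x in Set.Ioo (-(2 / f 0)) (2 / f 0), ENNReal.ofReal (f x) := by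
            refine setLIntegral_mono' measurableSet_Ioo fun x hx => ENNReal.ofReal_le_ofReal ?_
            rcases lt_trichotomy x 0 with h | h | h
            · rw [← hs x]
              exact hf.antitoneOn hs (by linarith) (by linarith [hx.1])
            · rw [h]
              exact hf.le_zero hs _
            · exact hf.antitoneOn hs h hx.2
        _ ≤ 1 := h1 ▸ setLIntegral_le_lintegral _ _
    rw [← ENNReal.ofReal_mul (hf.1 _), ENNReal.ofReal_le_one] at hmass
    have h4 : f (2 / f 0) ≤ f 0 / 4 := by
      rw [mul_div_assoc', div_le_one hM] at hmass
      linarith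
    have he : (1 / 4 : ℝ) ≤ Real.exp (-1) := by
      rw [Real.exp_neg, ← one_div]
      exact one_div_le_one_div_of_le (Real.exp_pos _) (by linarith [Real.exp_one_lt_d9])
    nlinarith
  have hpos : ∀ x, 0 ≤ x → f x ≤ Real.exp 1 * f 0 * Real.exp (-(f 0 / 2) * x) := by
    intro x hx
    rcases le_or_gt x (2 / f 0) with h | h
    · refine (hf.le_zero hs x).trans ?_
      rw [mul_right_comm, ← Real.exp_add]
      refine le_mul_of_one_le_left hM.le (Real.one_le_exp ?_)
      rw [le_div_iff₀ hM] at h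
      linarith
    -- Here `2 / f 0` lies between `0` and `x`, so log-concavity propagates the drop by a factor `e`
    -- to exponential decay at `x`.
    · have hx' : 0 < x := hx0.trans h
      set t := 2 / f 0 / x with ht
      have ht0 : 0 < t := by positivity
      have ht1 : t < 1 := by rwa [ht, div_lt_one hx']
      have h2 := hf.2 x 0 t (1 - t) ht0 (by linarith) (by ring)
      rw [mul_zero, add_zero, div_mul_cancel₀ _ hx'.ne'] at h2
      have h3 := h2.trans hsmall
      have h4 : f x ^ t ≤ f 0 ^ t * Real.exp (-1) := by
        have : f 0 = f 0 ^ t * f 0 ^ (1 - t) := by rw [← Real.rpow_add hM]; simp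
        have hp := Real.rpow_pos_of_pos hM (1 - t)
        refine le_of_mul_le_mul_right ?_ hp
        calc _ ≤ _ := h3
          _ = _ := by nth_rw 1 [this]; ring
      have h5 : f x ≤ f 0 * Real.exp (-1 / t) := by
        rw [← Real.rpow_le_rpow_iff (hf.1 x) (by positivity) ht0,
          Real.mul_rpow hM.le (Real.exp_pos _).le, ← Real.exp_mul, div_mul_cancel₀ _ ht0.ne']
        exact h4
      have h6 : -1 / t = -(f 0 / 2) * x := by
        rw [ht]; field_simp
      rw [h6] at h5
      refine h5.trans ?_
      rw [mul_assoc]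
      exact le_mul_of_one_le_left (by positivity) (Real.one_le_exp zero_le_one)
  intro x
  rcases le_total 0 x with h | h
  · rw [abs_of_nonneg h]; exact hpos x h
  · rw [abs_of_nonpos h, ← hs x]; exact hpos (-x) (by linarith)

lemma integrable_sq_mul_exp_neg_abs {c : ℝ} (hc : 0 < c) :
    Integrable (fun x : ℝ => x ^ 2 * Real.exp (-c * |x|)) ∧
      ∫ x : ℝ, x ^ 2 * Real.exp (-c * |x|) = 4 / c ^ 3 := by
  have key : ∫ x : ℝ, x ^ 2 * Real.exp (-c * |x|) = 4 / c ^ 3 := by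
    have h3 := integral_comp_abs (f := fun x : ℝ => x ^ 2 * Real.exp (-c * x))
    simp only [sq_abs] at h3
    rw [h3]
    have h4 := Real.integral_rpow_mul_exp_neg_mul_Ioi (a := 3) (r := c) (by norm_num) hc
    norm_num at h4
    simp only [neg_mul]
    rw [h4]
    field_simp
    norm_num
  -- A non-integrable function has Bochner integral 0, so the nonzero value proves integrability.
  refine ⟨not_imp_comm.1 integral_undef ?_, key⟩
  rw [key]
  positivity

/-- The second moment of a symmetric log-concave density is at most a constant times
`1 / f 0 ^ 2`. -/
lemma IsLogConcave.secondMoment {f : ℝ → ℝ} (fm : Measurable f) (hf : IsLogConcave f)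
    (hs : ∀ x, f (-x) = f x) (h1 : ∫⁻ x, ENNReal.ofReal (f x) = 1) :
    Integrable (fun x => x ^ 2) (volume.withDensity fun x => ENNReal.ofReal (f x)) ∧
      f 0 ^ 2 * ∫ x, x ^ 2 ∂(volume.withDensity fun x => ENNReal.ofReal (f x)) ≤ 100 := by
  obtain ⟨hM, hb⟩ := hf.le_exp hs h1
  obtain ⟨hi, he⟩ := integrable_sq_mul_exp_neg_abs (c := f 0 / 2) (by positivity)
  have hle : ∀ x, f x * x ^ 2 ≤
      Real.exp 1 * f 0 * (x ^ 2 * Real.exp (-(f 0 / 2) * |x|)) := fun x => by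
    nlinarith [mul_le_mul_of_nonneg_right (hb x) (sq_nonneg x)]
  have hi2 : Integrable fun x => f x * x ^ 2 := by
    refine (hi.const_mul (Real.exp 1 * f 0)).mono' (by fun_prop) (.of_forall fun x => ?_)
    rw [Real.norm_of_nonneg (mul_nonneg (hf.1 x) (sq_nonneg x))]
    exact hle x
  have hrw : ∀ x : ℝ, ((f x).toNNReal : ℝ) = f x := fun x => Real.coe_toNNReal _ (hf.1 x)
  constructor
  · have := (integrable_withDensity_iff_integrable_smul (μ := volume)
      (f := fun x => (f x).toNNReal) (by fun_prop) (g := fun x : ℝ => x ^ 2)).2 (by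
        simpa [NNReal.smul_def, hrw] using hi2)
    exact this
  · have := integral_withDensity_eq_integral_smul (μ := volume)
      (f := fun x => (f x).toNNReal) (by fun_prop) (fun x : ℝ => x ^ 2)
    simp only [NNReal.smul_def, hrw, smul_eq_mul] at this
    change f 0 ^ 2 * ∫ x, x ^ 2 ∂(volume.withDensity fun x => ((f x).toNNReal : ENNReal)) ≤ _
    rw [this]
    have h2 := integral_mono hi2 (hi.const_mul _) hle
    rw [integral_const_mul, he] at h2
    calc _ ≤ f 0 ^ 2 * (Real.exp 1 * f 0 * (4 / (f 0 / 2) ^ 3)) := by gcongr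
      _ = 32 * Real.exp 1 := by field_simp; ring
      _ ≤ 100 := by linarith [Real.exp_one_lt_d9]

/-- A symmetric log-concave probability measure has finite second moment, and an interval of
length `L` has measure at most `10 L / σ`. -/
lemma HasSymmetricLogConcaveDensity.concentration {μ : Measure ℝ} [IsProbabilityMeasure μ]
    (hμ : HasSymmetricLogConcaveDensity μ) :
    Integrable (fun x => x ^ 2) μ ∧ ∫ x, x ∂μ = 0 ∧ 0 < ∫ x, x ^ 2 ∂μ ∧
    ∀ s w v : ℝ, 0 < v → v ^ 2 ≤ ∫ x, x ^ 2 ∂μ →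
      μ {x | |x + s| ≤ w} ≤ ENNReal.ofReal (20 / v * w) := by
  obtain ⟨f, fm, fl, fs, rfl⟩ := hμ
  have f1 := lintegral_ofReal_eq_one (f := f) inferInstance
  obtain ⟨h1, h2⟩ := fl.secondMoment fm fs f1
  have hM := (fl.le_exp fs f1).1
  refine ⟨h1, ?_, ?_, fun s w v hv hv2 => ?_⟩
  · have hneg : (volume.withDensity fun x => ENNReal.ofReal (f x)).map (fun x => -x) =
        volume.withDensity fun x => ENNReal.ofReal (f x) := by
      ext S hS
      have hm : Measurable fun x : ℝ => -x := by fun_prop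
      rw [Measure.map_apply hm hS, withDensity_apply _ (hm hS), withDensity_apply _ hS]
      conv_rhs => rw [← Measure.map_neg_eq_self (volume : Measure ℝ)]
      rw [setLIntegral_map hS (by fun_prop) measurable_neg]
      refine lintegral_congr fun x => ?_
      simp [fs]
    have h3 : ∫ x, x ∂(volume.withDensity fun x => ENNReal.ofReal (f x)) =
        ∫ x, -x ∂(volume.withDensity fun x => ENNReal.ofReal (f x)) := by
      conv_lhs => rw [← hneg]
      rw [integral_map (by fun_prop) (by fun_prop)]
    rw [integral_neg] at h3
    linarith
  · rw [integral_pos_iff_support_of_nonneg (fun x => sq_nonneg x) h1]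
    have hsupp : Function.support (fun x : ℝ => x ^ 2) = {0}ᶜ := by
      ext x; simp
    rw [hsupp, pos_iff_ne_zero]
    intro h0
    have h4 : (volume.withDensity fun x => ENNReal.ofReal (f x)) {0} = 0 :=
      withDensity_absolutelyContinuous _ _ (by simp)
    have h5 := measure_union_le (μ := volume.withDensity fun x => ENNReal.ofReal (f x)) {0} {0}ᶜ
    rw [Set.union_compl_self, measure_univ, h4, h0] at h5
    simp at h5
  -- The second-moment bound gives `(f 0 * v) ^ 2 ≤ 100`; the interval below has length `2 * w`.
  · have hle : f 0 ≤ 10 / v := by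
      rw [le_div_iff₀ hv]
      refine abs_le_of_sq_le_sq' (by nlinarith [sq_nonneg (f 0)]) (by norm_num) |>.2
    have hset : {x | |x + s| ≤ w} = Set.Icc (-w - s) (w - s) := by
      ext x
      simp only [Set.mem_ofPred_eq, abs_le, Set.mem_Icc]
      constructor <;> rintro ⟨h, h'⟩ <;> constructor <;> linarith
    rw [hset, withDensity_apply _ measurableSet_Icc]
    rcases lt_or_ge w 0 with hw | hw
    · rw [Set.Icc_eq_empty (by linarith)]
      simp
    calc _ ≤ ∫⁻ x in Set.Icc (-w - s) (w - s), ENNReal.ofReal (f 0) :=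
          lintegral_mono fun x => ENNReal.ofReal_le_ofReal (fl.le_zero fs x)
      _ = ENNReal.ofReal (f 0 * (2 * w)) := by
          rw [setLIntegral_const, Real.volume_Icc, ENNReal.ofReal_mul hM.le]
          congr 2
          ring
      _ ≤ _ := by
          refine ENNReal.ofReal_le_ofReal ?_
          calc f 0 * (2 * w) ≤ 10 / v * (2 * w) := by gcongr
            _ = _ := by ring

/-! ### Small-ball estimates for sums. -/

/-- Small-ball estimate for a symmetric log-concave variable `Z` with an independent random centre
`-S` and an independent random radius `W`. -/
lemma measureReal_abs_add_le {Ω : Type u} [MeasurableSpace Ω] {P : Measure Ω}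
    [IsProbabilityMeasure P] {Z S W : Ω → ℝ} (hZ : Measurable Z) (hS : Measurable S)
    (hW : Measurable W) (hind : IndepFun (fun ω => (S ω, W ω)) Z P)
    (hd : HasSymmetricLogConcaveDensity (P.map Z)) {v e : ℝ} (hv : 0 < v)
    (hv2 : v ^ 2 ≤ ∫ ω, Z ω ^ 2 ∂P) (hWi : Integrable W P) (he : ∫ ω, |W ω| ∂P ≤ e) :
    P.real {ω | |Z ω + S ω| ≤ W ω} ≤ 20 / v * e := by
  have : IsProbabilityMeasure (P.map Z) := Measure.isProbabilityMeasure_map hZ.aemeasurable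
  have hSW : Measurable fun ω => (S ω, W ω) := hS.prodMk hW
  have hcon := hd.concentration.2.2.2
  have hv3 : v ^ 2 ≤ ∫ x, x ^ 2 ∂(P.map Z) := by
    rwa [integral_map hZ.aemeasurable (by fun_prop)]
  have hE : MeasurableSet {p : (ℝ × ℝ) × ℝ | |p.2 + p.1.1| ≤ p.1.2} :=
    measurableSet_le (by fun_prop) (by fun_prop)
  have he0 : 0 ≤ e := (integral_nonneg fun ω => abs_nonneg _).trans he
  refine ENNReal.toReal_le_of_le_ofReal (by positivity) ?_
  calc P {ω | |Z ω + S ω| ≤ W ω}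
      = P.map (fun ω => ((S ω, W ω), Z ω)) {p : (ℝ × ℝ) × ℝ | |p.2 + p.1.1| ≤ p.1.2} := by
        rw [Measure.map_apply (hSW.prodMk hZ) hE]
        rfl
    _ = ∫⁻ q, P.map Z {z | |z + q.1| ≤ q.2} ∂(P.map fun ω => (S ω, W ω)) := by
        rw [(indepFun_iff_map_prod_eq_prod_map_map hSW.aemeasurable hZ.aemeasurable).1 hind,
          Measure.prod_apply hE]
        rfl
    _ ≤ ∫⁻ q, ENNReal.ofReal (20 / v * |q.2|) ∂(P.map fun ω => (S ω, W ω)) := by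
        refine lintegral_mono fun q => (hcon _ _ _ hv hv3).trans (ENNReal.ofReal_le_ofReal ?_)
        gcongr
        exact le_abs_self _
    _ = ∫⁻ ω, ENNReal.ofReal (20 / v * |W ω|) ∂P := by
        rw [lintegral_map (by fun_prop) hSW]
    _ = ENNReal.ofReal (20 / v * ∫ ω, |W ω| ∂P) := by
        rw [← integral_const_mul, ofReal_integral_eq_lintegral_ofReal (hWi.abs.const_mul _)
          (.of_forall fun ω => by positivity)]
    _ ≤ ENNReal.ofReal (20 / v * e) := by gcongr

/-- `σ` is the common standard deviation: independence and zero means make the variables orthogonal,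
and `E|S| ≤ √(E S²)`. -/
lemma IsIID.moments {Ω : Type u} [MeasurableSpace Ω] {P : Measure Ω} [IsProbabilityMeasure P]
    {n : ℕ} {X : Fin n → Ω → ℝ} (hX : IsIID P X)
    (hd : ∀ i, HasSymmetricLogConcaveDensity (P.map (X i))) :
    ∃ σ : ℝ, 0 < σ ∧ ∀ (a : Fin n → ℝ) (J : Finset (Fin n)),
      Integrable (fun ω => ∑ i ∈ J, a i * X i ω) P ∧
      ∫ ω, (∑ i ∈ J, a i * X i ω) ^ 2 ∂P = σ ^ 2 * ∑ i ∈ J, a i ^ 2 ∧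
      ∫ ω, |∑ i ∈ J, a i * X i ω| ∂P ≤ σ * √(∑ i ∈ J, a i ^ 2) := by
  obtain ⟨hm, hind, hid⟩ := hX
  have hprob : ∀ i, IsProbabilityMeasure (P.map (X i)) := fun i =>
    Measure.isProbabilityMeasure_map (hm i).aemeasurable
  have h2 : ∀ i, MemLp (X i) 2 P := fun i => by
    rw [memLp_two_iff_integrable_sq (hm i).aestronglyMeasurable]
    have := (hd i).concentration.1
    rwa [integrable_map_measure (by fun_prop) (hm i).aemeasurable] at this
  have h0 : ∀ i, ∫ ω, X i ω ∂P = 0 := fun i => by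
    have := (hd i).concentration.2.1
    rwa [integral_map (hm i).aemeasurable (by fun_prop)] at this
  have hpos : ∀ i, 0 < ∫ ω, X i ω ^ 2 ∂P := fun i => by
    have := (hd i).concentration.2.2.1
    rwa [integral_map (hm i).aemeasurable (by fun_prop)] at this
  obtain ⟨s, hs, hs2⟩ : ∃ s : ℝ, 0 < s ∧ ∀ i, ∫ ω, X i ω ^ 2 ∂P = s := by
    by_cases hn : Nonempty (Fin n)
    · obtain ⟨i⟩ := hn
      refine ⟨_, hpos i, fun j => ?_⟩
      have := ((hid j i).comp (u := fun x : ℝ => x ^ 2) (by fun_prop)).integral_eq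
      exact this
    -- For `n = 0` there is no variable, and any positive value serves.
    · exact ⟨1, one_pos, fun i => (hn ⟨i⟩).elim⟩
  refine ⟨√s, Real.sqrt_pos.2 hs, fun a J => ?_⟩
  have hL : MemLp (fun ω => ∑ i ∈ J, a i * X i ω) 2 P :=
    memLp_finsetSum _ fun i _ => (h2 i).const_mul (a i)
  have hsq : ∫ ω, (∑ i ∈ J, a i * X i ω) ^ 2 ∂P = √s ^ 2 * ∑ i ∈ J, a i ^ 2 := by
    have hv := IndepFun.variance_sum (μ := P) (X := fun i ω => a i * X i ω) (s := J)
      (fun i _ => (h2 i).const_mul (a i)) (fun i _ j _ hij =>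
        (hind.indepFun hij).comp (φ := fun x => a i * x) (ψ := fun x => a j * x)
          (by fun_prop) (by fun_prop))
    have hmean : ∫ ω, ∑ i ∈ J, a i * X i ω ∂P = 0 := by
      rw [integral_finsetSum _ fun i _ => ((h2 i).integrable one_le_two).const_mul (a i)]
      simp [integral_const_mul, h0]
    rw [show (∑ i ∈ J, fun ω => a i * X i ω) = fun ω => ∑ i ∈ J, a i * X i ω by
      ext ω; simp, variance_of_integral_eq_zero (by fun_prop) hmean] at hv
    rw [hv, Real.sq_sqrt hs.le, Finset.mul_sum]
    refine Finset.sum_congr rfl fun i _ => ?_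
    rw [variance_const_mul, variance_of_integral_eq_zero (by fun_prop) (h0 i), hs2, mul_comm]
  refine ⟨hL.integrable one_le_two, hsq, ?_⟩
  have hvar := variance_nonneg (fun ω => |∑ i ∈ J, a i * X i ω|) P
  rw [variance_eq_sub (by simpa only [Real.norm_eq_abs] using hL.norm)] at hvar
  simp only [Pi.pow_apply, sq_abs] at hvar
  rw [hsq] at hvar
  rw [← Real.sqrt_mul_self (Real.sqrt_nonneg s), ← Real.sqrt_mul (by positivity)]
  refine Real.le_sqrt_of_sq_le ?_
  nlinarith

/-- The small-ball estimate for complementary blocks of an independent sum. -/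
lemma IsIID.measureReal_block_le {Ω : Type u} [MeasurableSpace Ω] {P : Measure Ω}
    [IsProbabilityMeasure P] {n : ℕ} {X : Fin n → Ω → ℝ} (hX : IsIID P X)
    (hd : ∀ i, HasSymmetricLogConcaveDensity (P.map (X i))) (α β : EuclideanSpace ℝ (Fin n))
    {K J : Finset (Fin n)} (hKJ : Disjoint K J) {κ v : ℝ} (hκ : 0 ≤ κ) (hv : 0 < v)
    (hvK : v ^ 2 ≤ ∑ i ∈ K, α i ^ 2) :
    P.real {ω | |∑ i ∈ K, α i * X i ω + ∑ i ∈ J, α i * X i ω| ≤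
      2 * |∑ i ∈ J, β i * X i ω| + 2 * κ * |∑ i ∈ J, α i * X i ω|} ≤
      40 / v * (‖β‖ + κ * ‖α‖) := by
  obtain ⟨σ, hσ, hmom⟩ := hX.moments hd
  have hm := hX.1
  have hnorm : ∀ γ : EuclideanSpace ℝ (Fin n), √(∑ i ∈ J, γ i ^ 2) ≤ ‖γ‖ := fun γ => by
    rw [EuclideanSpace.norm_eq]
    refine Real.sqrt_le_sqrt ?_
    simp only [Real.norm_eq_abs, sq_abs]
    exact Finset.sum_le_sum_of_subset_of_nonneg (Finset.subset_univ _) fun i _ _ => sq_nonneg _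
  have hdK : HasSymmetricLogConcaveDensity (P.map fun ω => ∑ i ∈ K, α i * X i ω) := by
    refine (hX.sum_density hd α K).resolve_left fun h => ?_
    rw [Finset.sum_eq_zero fun i hi => by rw [h i hi]; norm_num] at hvK
    nlinarith
  -- Centre and radius are functions of the block `J` alone, hence independent of the sum over `K`.
  have hind := (hX.2.1.indepFun_finset J K hKJ.symm hm).comp
    (φ := fun x : J → ℝ => (∑ i : J, α i * x i,
      2 * |∑ i : J, β i * x i| + 2 * κ * |∑ i : J, α i * x i|))
    (ψ := fun x : K → ℝ => ∑ i : K, α i * x i) (by fun_prop) (by fun_prop)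
  have hsum : ∀ (L : Finset (Fin n)) (γ : EuclideanSpace ℝ (Fin n)) (ω : Ω),
      ∑ i : L, γ i * X i ω = ∑ i ∈ L, γ i * X i ω := fun L γ ω =>
    Finset.sum_coe_sort L fun i => γ i * X i ω
  simp only [Function.comp_def, hsum] at hind
  have hWi : Integrable (fun ω => 2 * |∑ i ∈ J, β i * X i ω| +
      2 * κ * |∑ i ∈ J, α i * X i ω|) P :=
    ((hmom β J).1.abs.const_mul _).add ((hmom α J).1.abs.const_mul _)
  have he : ∫ ω, abs (2 * |∑ i ∈ J, β i * X i ω| + 2 * κ * |∑ i ∈ J, α i * X i ω|) ∂P ≤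
      2 * (σ * ‖β‖) + 2 * κ * (σ * ‖α‖) := by
    have habs : ∀ ω, abs (2 * |∑ i ∈ J, β i * X i ω| + 2 * κ * |∑ i ∈ J, α i * X i ω|) =
        2 * |∑ i ∈ J, β i * X i ω| + 2 * κ * |∑ i ∈ J, α i * X i ω| := fun ω =>
      abs_of_nonneg (by positivity)
    simp only [habs]
    rw [integral_add ((hmom β J).1.abs.const_mul _) ((hmom α J).1.abs.const_mul _),
      integral_const_mul, integral_const_mul]
    gcongr
    · exact (hmom β J).2.2.trans (by gcongr; exact hnorm β)
    · exact (hmom α J).2.2.trans (by gcongr; exact hnorm α)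
  have := measureReal_abs_add_le (by fun_prop) (by fun_prop) (by fun_prop) hind hdK
    (v := σ * v) (by positivity) (by
      rw [(hmom α K).2.1, mul_pow]
      gcongr) hWi he
  refine this.trans_eq ?_
  field_simp
  ring

/-! ### An explicit admissible constant. -/

/-- Greedy choice: when the running sum first reaches `s / 4`, it has overshot by less than `s / 4`.
-/
lemma exists_balanced_subset {n : ℕ} (w : Fin n → ℝ) {s : ℝ} (hs : 0 < s)
    (hw : ∀ i, w i < s / 4) (J : Finset (Fin n)) :
    ∑ i ∈ J, w i < s / 4 ∨ ∃ K : Finset (Fin n), s / 4 ≤ ∑ i ∈ K, w i ∧ ∑ i ∈ K, w i < s / 2 := by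
  classical
  induction J using Finset.induction_on with
  | empty => left; simpa using hs
  | insert j J hj ih =>
    rcases ih with ih | ih
    · rcases lt_or_ge (∑ i ∈ insert j J, w i) (s / 4) with h | h
      · exact .inl h
      · refine .inr ⟨_, h, ?_⟩
        rw [Finset.sum_insert hj]
        linarith [hw j]
    · exact .inr ih

lemma logConcaveBound_const : LogConcaveBound.{u} 240 := by
  intro Ω _ P _ n X hX hd α β hα
  have hA : 0 < ‖α‖ := norm_pos_iff.2 hα
  have hb : 0 ≤ ‖β‖ := norm_nonneg β
  have hA2 : ∑ i, α i ^ 2 = ‖α‖ ^ 2 := (EuclideanSpace.real_norm_sq_eq α).symm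
  have hhalf : 0 < ‖α‖ / 2 := by positivity
  by_cases hw : ∀ i, α i ^ 2 < ‖α‖ ^ 2 / 4
  · obtain ⟨K, hK, hK2⟩ := (exists_balanced_subset (fun i => α i ^ 2) (by positivity) hw
      Finset.univ).resolve_left (by
        rw [hA2]
        nlinarith [pow_pos hA 2])
    have hKc := Finset.sum_add_sum_compl K fun i => α i ^ 2
    have h1 := hX.measureReal_block_le hd α β (disjoint_compl_right (a := K)) le_rfl hhalf
      (by linarith)
    have h2 := hX.measureReal_block_le hd α β (disjoint_compl_left (a := K)) le_rfl hhalf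
      (by linarith)
    calc domProb P α β X ≤ _ := measureReal_mono (fun ω hω => ?_)
      _ ≤ _ := measureReal_union_le _ _
      _ ≤ _ := add_le_add h1 h2
      _ = 160 * (‖β‖ / ‖α‖) := by field_simp; ring
      _ ≤ _ := by gcongr; norm_num
    -- If `|⟨α, X⟩|` exceeded twice each block part of `⟨β, X⟩`, it would exceed `|⟨β, X⟩|`. Each of
    -- the two events costs `80 * (‖β‖ / ‖α‖)`.
    simp only [Set.mem_ofPred_eq] at hω
    rw [← Finset.sum_add_sum_compl K, ← Finset.sum_add_sum_compl K] at hω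
    simp only [mul_zero, zero_mul, add_zero, Set.mem_union, Set.mem_ofPred_eq]
    rw [add_comm (∑ i ∈ Kᶜ, α i * X i ω)]
    have h3 := abs_add_le (∑ i ∈ K, β i * X i ω) (∑ i ∈ Kᶜ, β i * X i ω)
    by_contra! h
    linarith [h.1, h.2]
  · push Not at hw
    obtain ⟨i, hi⟩ := hw
    have hαi : ‖α‖ / 2 ≤ |α i| := by
      refine le_of_sq_le_sq ?_ (abs_nonneg _)
      rw [sq_abs]
      linarith
    have hαi0 : 0 < |α i| := hhalf.trans_le hαi
    have hβi : |β i| ≤ ‖β‖ := by simpa using PiLp.norm_apply_le β i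
    -- For `‖α‖ ≤ 4 * ‖β‖` the bound is trivial; otherwise `κ = |β i| / |α i| ≤ 1 / 2`, which
    -- permits the absorption below.
    rcases le_or_gt (‖α‖) (4 * ‖β‖) with h4 | h4
    · calc domProb P α β X ≤ 1 := measureReal_le_one
        _ ≤ 4 * (‖β‖ / ‖α‖) := by
          rw [mul_div_assoc', le_div_iff₀ hA]
          linarith
        _ ≤ _ := by gcongr; norm_num
    have hκ : |β i| / |α i| ≤ 2 * (‖β‖ / ‖α‖) := by
      rw [mul_div_assoc', div_le_div_iff₀ hαi0 hA]
      nlinarith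
    have hκ2 : |β i| / |α i| ≤ 1 / 2 := by
      refine hκ.trans ?_
      rw [mul_div_assoc', div_le_iff₀ hA]
      linarith
    have h1 := hX.measureReal_block_le hd α β (disjoint_compl_right (a := {i}))
      (κ := |β i| / |α i|) (by positivity) hhalf (by
        rw [Finset.sum_singleton]
        linarith)
    calc domProb P α β X ≤ _ := measureReal_mono (fun ω hω => ?_)
      _ ≤ _ := h1
      _ ≤ 40 / (‖α‖ / 2) * (‖β‖ + 2 * (‖β‖ / ‖α‖) * ‖α‖) := by gcongr
      _ = 240 * (‖β‖ / ‖α‖) := by field_simp; ring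
    simp only [Set.mem_ofPred_eq] at hω ⊢
    rw [← Finset.sum_add_sum_compl {i}, ← Finset.sum_add_sum_compl {i}] at hω
    simp only [Finset.sum_singleton] at hω ⊢
    set S := ∑ j ∈ {i}ᶜ, α j * X j ω
    set T := ∑ j ∈ {i}ᶜ, β j * X j ω
    set κ := |β i| / |α i|
    have h2 : |β i * X i ω| = κ * |α i * X i ω| := by
      rw [abs_mul, abs_mul, ← mul_assoc, div_mul_cancel₀ _ hαi0.ne']
    have h3 := abs_add_le (β i * X i ω) T
    have h5 : |α i * X i ω| ≤ |α i * X i ω + S| + |S| := by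
      have := abs_sub (α i * X i ω + S) S
      rwa [add_sub_cancel_right] at this
    have h6 : 0 ≤ κ := by positivity
    -- Together these give `(1 - κ) * |⟨α, X⟩| ≤ |T| + κ * |S|`, and `1 - κ ≥ 1 / 2`.
    nlinarith [mul_le_mul_of_nonneg_left h5 h6, abs_nonneg (α i * X i ω + S)]

/-! ### Passage to scale mixtures. -/

/-- The pointwise estimate behind the passage to scale mixtures: Cauchy–Schwarz and AM-GM. -/
lemma norm_ratio_le {n : ℕ} {a b x : Fin n → ℝ} {A M : ℝ} (hA : 0 < A) (hM : 0 < M)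
    (ha : ∑ i, a i ^ 2 = A ^ 2) (hx : ∀ i, 0 < x i) :
    √(∑ i, (b i * x i) ^ 2) / √(∑ i, (a i * x i) ^ 2) ≤
      (1 / 2) * ((1 / (A * M)) * ∑ i, b i ^ 2 * x i ^ 2 +
        (M / A ^ 3) * ∑ i, a i ^ 2 * (1 / x i ^ 2)) := by
  set p := ∑ i, (a i * x i) ^ 2 with hp
  set r := ∑ i, a i ^ 2 * (1 / x i ^ 2) with hr
  have hq : ∑ i, b i ^ 2 * x i ^ 2 = ∑ i, (b i * x i) ^ 2 := by simp only [mul_pow]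
  rw [hq]
  set q := ∑ i, (b i * x i) ^ 2
  have hp0 : 0 ≤ p := Finset.sum_nonneg fun i _ => sq_nonneg _
  have hq0 : 0 ≤ q := Finset.sum_nonneg fun i _ => sq_nonneg _
  have hr0 : 0 ≤ r := Finset.sum_nonneg fun i _ => by positivity
  -- Cauchy–Schwarz for `a i ^ 2 = (a i * x i) * (a i / x i)`.
  have hcs : (A ^ 2) ^ 2 ≤ p * r := by
    rw [← ha]
    refine Finset.sum_sq_le_sum_mul_sum_of_sq_le_mul _ (fun i _ => sq_nonneg _)
      (fun i _ => by positivity) fun i _ => ?_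
    have := (hx i).ne'
    refine le_of_eq ?_
    field_simp
  have hp1 : 0 < p := by
    refine hp0.lt_of_ne fun h => ?_
    rw [← h, zero_mul] at hcs
    have : 0 < (A ^ 2) ^ 2 := by positivity
    linarith
  have hsp := Real.sqrt_pos.2 hp1
  have h1 : 1 / p ≤ r / A ^ 4 := by
    rw [div_le_div_iff₀ hp1 (by positivity)]
    nlinarith
  -- AM-GM with weight `A * M`; for `M = ‖β‖` both terms have expectation at most `B * (‖β‖ / ‖α‖)`.
  have h2 : √q / √p ≤ (1 / 2) * (1 / (A * M) * q + A * M * (1 / p)) := by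
    have hs1 := Real.sq_sqrt hp0
    have hs2 := Real.sq_sqrt hq0
    have hAM : 0 < A * M := by positivity
    have h3 : 0 ≤ (√q - A * M * (1 / √p)) ^ 2 / (A * M) := by positivity
    have h4 : (√q - A * M * (1 / √p)) ^ 2 / (A * M) =
        1 / (A * M) * √q ^ 2 + A * M * (1 / √p ^ 2) - 2 * (√q / √p) := by
      field_simp
      ring
    rw [hs1, hs2] at h4
    linarith
  refine h2.trans ?_
  have h5 : A * M * (1 / p) ≤ A * M * (r / A ^ 4) := by gcongr
  have h6 : A * M * (r / A ^ 4) = M / A ^ 3 * r := by field_simp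
  linarith

lemma LogConcaveBound.mixed {C : ℝ} (hC : LogConcaveBound.{u} C) : MixedLogConcaveBound.{u} C := by
  intro Ω _ P _ n ξ Y B hY hd hξ hpos h2 hinv hind α β hα
  have hA : 0 < ‖α‖ := norm_pos_iff.2 hα
  -- Testing admissibility with `β = α` gives the sign of `C`.
  have hC0 : 0 ≤ C := by
    have h := hC Ω P n Y hY hd α α hα
    rw [div_self hA.ne', mul_one] at h
    exact measureReal_nonneg.trans h
  have hYm := hY.1
  have hξm := hξ.1
  have hξv : Measurable fun ω i => ξ i ω := measurable_pi_lambda _ hξm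
  have hYv : Measurable fun ω i => Y i ω := measurable_pi_lambda _ hYm
  have hB : 0 ≤ B := by
    obtain ⟨i⟩ : Nonempty (Fin n) := by
      by_contra h
      rw [not_nonempty_iff] at h
      exact hα (Subsingleton.elim _ _)
    exact (integral_nonneg fun ω => sq_nonneg _).trans (h2 i).2
  let sc : EuclideanSpace ℝ (Fin n) → (Fin n → ℝ) → EuclideanSpace ℝ (Fin n) := fun γ x =>
    WithLp.toLp 2 fun i => γ i * x i
  have hnorm : ∀ γ x, ‖sc γ x‖ = √(∑ i, (γ i * x i) ^ 2) := fun γ x => by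
    simp only [EuclideanSpace.norm_eq, sc, Real.norm_eq_abs, sq_abs]
  have hsc0 : ∀ x : Fin n → ℝ, (∀ i, 0 < x i) → sc α x ≠ 0 := fun x hx h => hα (by
    ext i
    have := congrArg (fun v : EuclideanSpace ℝ (Fin n) => v i) h
    simpa [sc, (hx i).ne'] using this)
  have hposall : ∀ᵐ ω ∂P, ∀ i, 0 < ξ i ω := ae_all_iff.2 hpos
  let E : Set ((Fin n → ℝ) × (Fin n → ℝ)) :=
    {p | |∑ i, α i * (p.1 i * p.2 i)| ≤ |∑ i, β i * (p.1 i * p.2 i)|}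
  have hE : MeasurableSet E := measurableSet_le (by fun_prop) (by fun_prop)
  have hcond : P {ω | |∑ i, α i * (ξ i ω * Y i ω)| ≤ |∑ i, β i * (ξ i ω * Y i ω)|} ≤
      ∫⁻ ω, ENNReal.ofReal (C * (‖sc β fun i => ξ i ω‖ / ‖sc α fun i => ξ i ω‖)) ∂P := by
    calc _ = P.map (fun ω => ((fun i => ξ i ω), fun i => Y i ω)) E := by
          rw [Measure.map_apply (hξv.prodMk hYv) hE]
          rfl
      _ = ∫⁻ x, P.map (fun ω i => Y i ω) (Prod.mk x ⁻¹' E) ∂(P.map fun ω i => ξ i ω) := by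
          rw [(indepFun_iff_map_prod_eq_prod_map_map hξv.aemeasurable hYv.aemeasurable).1 hind,
            Measure.prod_apply hE]
      _ = ∫⁻ ω, P.map (fun ω i => Y i ω) (Prod.mk (fun i => ξ i ω) ⁻¹' E) ∂P := by
          rw [lintegral_map (measurable_measure_prodMk_left hE) hξv]
      _ ≤ _ := by
          refine lintegral_mono_ae ?_
          filter_upwards [hposall] with ω hω
          -- With the scales frozen at `ξ · ω`, they are absorbed into the coefficients.
          have h := hC Ω P n Y hY hd (sc α fun i => ξ i ω) (sc β fun i => ξ i ω) (hsc0 _ hω)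
          rw [Measure.map_apply hYv (measurable_prodMk_left hE)]
          rw [domProb, measureReal_def,
            ← ENNReal.le_ofReal_iff_toReal_le (by finiteness) (by positivity)] at h
          refine le_trans (le_of_eq ?_) h
          congr 1
          ext ω'
          simp [E, sc, mul_assoc]
  -- The choice `M = ‖β‖` needs `β ≠ 0`; for `β = 0` the conditional bound is already zero.
  rcases (norm_nonneg β).eq_or_lt with hβ | hβ
  · have hβ0 : β = 0 := norm_eq_zero.1 hβ.symm
    have : ∀ x, sc β x = 0 := fun x => by
      ext i
      simp [sc, hβ0]
    simp only [this, norm_zero, zero_div, mul_zero, ENNReal.ofReal_zero, lintegral_zero] at hcond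
    rw [← hβ, zero_div, mul_zero, domProb, measureReal_def, le_antisymm hcond zero_le]
    simp
  let g : Ω → ℝ := fun ω => (1 / 2) * ((1 / (‖α‖ * ‖β‖)) * ∑ i, β i ^ 2 * ξ i ω ^ 2 +
        (‖β‖ / ‖α‖ ^ 3) * ∑ i, α i ^ 2 * (1 / ξ i ω ^ 2))
  have hi1 : Integrable (fun ω => ∑ i, β i ^ 2 * ξ i ω ^ 2) P :=
    integrable_finsetSum _ fun i _ => (h2 i).1.const_mul _
  have hi2 : Integrable (fun ω => ∑ i, α i ^ 2 * (1 / ξ i ω ^ 2)) P :=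
    integrable_finsetSum _ fun i _ => (hinv i).1.const_mul _
  have hgi : Integrable g P := ((hi1.const_mul _).add (hi2.const_mul _)).const_mul _
  have hsq : ∀ γ : EuclideanSpace ℝ (Fin n), ∑ i, γ i ^ 2 = ‖γ‖ ^ 2 := fun γ =>
    (EuclideanSpace.real_norm_sq_eq γ).symm
  have hge : ∫ ω, g ω ∂P ≤ B * (‖β‖ / ‖α‖) := by
    simp only [g]
    rw [integral_const_mul, integral_add (hi1.const_mul _) (hi2.const_mul _), integral_const_mul,
      integral_const_mul, integral_finsetSum _ fun i _ => (h2 i).1.const_mul _,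
      integral_finsetSum _ fun i _ => (hinv i).1.const_mul _]
    simp only [integral_const_mul]
    have e1 : ∑ i, β i ^ 2 * ∫ ω, ξ i ω ^ 2 ∂P ≤ ‖β‖ ^ 2 * B := by
      rw [← hsq, Finset.sum_mul]
      exact Finset.sum_le_sum fun i _ => mul_le_mul_of_nonneg_left (h2 i).2 (sq_nonneg _)
    have e2 : ∑ i, α i ^ 2 * ∫ ω, 1 / ξ i ω ^ 2 ∂P ≤ ‖α‖ ^ 2 * B := by
      rw [← hsq, Finset.sum_mul]
      exact Finset.sum_le_sum fun i _ => mul_le_mul_of_nonneg_left (hinv i).2 (sq_nonneg _)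
    calc _ ≤ (1 / 2) * ((1 / (‖α‖ * ‖β‖)) * (‖β‖ ^ 2 * B) +
          (‖β‖ / ‖α‖ ^ 3) * (‖α‖ ^ 2 * B)) := by gcongr
      _ = _ := by field_simp; ring
  have hg0 : ∀ ω, 0 ≤ g ω := fun ω => by positivity
  refine ENNReal.toReal_le_of_le_ofReal (by positivity) (hcond.trans ?_)
  calc _ ≤ ∫⁻ ω, ENNReal.ofReal (C * g ω) ∂P := by
        refine lintegral_mono_ae ?_
        filter_upwards [hposall] with ω hω
        refine ENNReal.ofReal_le_ofReal (mul_le_mul_of_nonneg_left ?_ hC0)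
        rw [hnorm, hnorm]
        exact norm_ratio_le hA hβ (hsq α) hω
    _ = ENNReal.ofReal (∫ ω, C * g ω ∂P) :=
        (ofReal_integral_eq_lintegral_ofReal (hgi.const_mul _)
          (.of_forall fun ω => mul_nonneg hC0 (hg0 ω))).symm
    _ ≤ _ := by
        refine ENNReal.ofReal_le_ofReal ?_
        rw [integral_const_mul, mul_assoc]
        exact mul_le_mul_of_nonneg_left hge hC0

theorem mainTheorem5 :
    (∃ C : ℝ, 0 < C ∧ LogConcaveBound.{u} C ∧ MixedLogConcaveBound.{u} C) ∧
      ∀ C : ℝ, LogConcaveBound.{u} C → MixedLogConcaveBound.{u} C :=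
  ⟨⟨240, by norm_num, logConcaveBound_const, logConcaveBound_const.mixed⟩, fun _ hC => hC.mixed⟩
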